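/- Let $\mathbb N=\{1,2,\dots\}$ and let $(\lambda_{nk})_{n,k\in\mathbb N}$ be real numbers, decreasing in $k$ for each $n$, with $1/n^2\le\lambda_{nk}\le 1$. Put $G_1=\{z\in\mathbb C: 1/2<|z|<1,\ 0<\arg z<\pi\}$ and $G=G_1\times\mathbb C\subset\mathbb C^2$, and let $d(z_1)$ be the distance of $z_1\in G_1$ to $\mathbb C\setminus G_1$. For $n\in\mathbb N$ let $\theta_n=1/(2n)$ and $I_n=[\theta_n-\tfrac1{2^5n^2},\theta_n+\tfrac1{2^5n^2}]$. Let $\hat w_k:[0,\pi]\to(0,\infty)$ be equal to $\lambda_{nk}$ on $I_n$ for every $n$, with $\hat w_k(\theta_n+\tfrac1{2^4n^2})=\hat w_k(0)=\hat w_k(\pi)=1$ for every $n$, and extended affinely for the other $\theta$; put $w_k(re^{i\theta})=\hat w_k(\theta)$ for $re^{i\theta}\in G_1$. For $z_1\in G_1$ let $u_k(z_1,t)=(1+t)^{-\frac{k-1}{2k}}$ if $t\ge k+1$, $u_k(z_1,t)=\bigl(1+\tfrac1{d(z_1)}+t\bigr)^{-\frac{k-1}{2k}}$ if $0\le t\le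 k$, and let $u_k(z_1,\cdot)$ be affine on $[k,k+1]$. Let $V=(v_k)_{k\ge1}$ be the decreasing sequence of continuous strictly positive weights $v_k(z_1,z_2)=w_k(z_1)\,u_k(z_1,|z_2|)$ on $G$. For a weight $v$ put $p_v(f)=\sup_{z\in G}v(z)|f(z)|$. Let $\mathcal VC(G)=\mathrm{ind}_k\,Cv_k(G)$ be the locally convex inductive limit of the Banach spaces $Cv_k(G)=\{f:G\to\mathbb C \text{ continuous}: p_{v_k}(f)<\infty\}$ with the norms $p_{v_k}$. Let $\overline V$ be the set of all continuous $\bar v:G\to(0,\infty)$ such that for every $k$ there is $C_k>0$ with $\bar v\le C_kv_k$, and let $C\overline V(G)$ (resp. $H\overline V(G)$) be the space of all continuous (resp. holomorphic) $f:G\to\mathbb C$ with $p_{\bar v}(f)<\infty$ for all $\bar v\in\overline V$, with the topology given by the seminorms $p_{\bar v}$, $\bar v\in\overline V$. Then: 1. $V$ satisfies condition $(M)$: for each $k\in\mathbb N$ and each subset $Y$ of $G$ which is not relatively compact in $G$ there is $k'>k$ with $\inf_{y\in Y}v_{k'}(y)/v_k(y)=0$. 2. $\mathcal VC(G)=C\overline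 V(G)$ holds algebraically and topologically. 3. $H\overline V(G)$ is a Montel space, in the sense that it is a Hausdorff locally convex space in which every closed bounded set is compact (barrelledness is not part of the notion), and all its bounded subsets are metrizable. -/

import Mathlib

open Set Topology

/-! ### Weights and weighted spaces of continuous functions -/

/-- A weight on `X`: a continuous strictly positive real function. -/
structure Weight (X : Type*) [TopologicalSpace X] where
  toFun : X → ℝ
  continuous_toFun : Continuous toFun
  pos_toFun : ∀ x, 0 < toFun x

instance Weight.instCoeFun {X : Type*} [TopologicalSpace X] :
    CoeFun (Weight X) (fun _ => X → ℝ) := ⟨Weight.toFun⟩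

section Weighted

variable {X : Type*} [TopologicalSpace X]

/-- The functions `f` in `S` (a space of continuous functions on `X`, for instance all of them or
the holomorphic ones) for which `v |f|` is bounded. -/
def weightedSubmodule (S : Submodule ℂ C(X, ℂ)) (v : Weight X) : Submodule ℂ C(X, ℂ) where
  carrier := {f | f ∈ S ∧ BddAbove (range fun x => v x * ‖f x‖)}
  zero_mem' := by
    refine ⟨S.zero_mem, 0, ?_⟩
    rintro _ ⟨x, rfl⟩
    simp
  add_mem' := by
    rintro f g ⟨hf, a, ha⟩ ⟨hg, b, hb⟩
    refine ⟨S.add_mem hf hg, a + b, ?_⟩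
    rintro _ ⟨x, rfl⟩
    have h1 := ha (mem_range_self x)
    have h2 := hb (mem_range_self x)
    have h3 := mul_le_mul_of_nonneg_left (norm_add_le (f x) (g x)) (v.pos_toFun x).le
    simp only [ContinuousMap.add_apply] at h1 h2 ⊢
    linarith
  smul_mem' := by
    rintro c f ⟨hf, a, ha⟩
    refine ⟨S.smul_mem c hf, ‖c‖ * a, ?_⟩
    rintro _ ⟨x, rfl⟩
    have h1 := mul_le_mul_of_nonneg_left (ha (mem_range_self x)) (norm_nonneg c)
    simp only [ContinuousMap.smul_apply, norm_smul] at h1 ⊢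
    linarith

/-- The weighted supremum seminorm `p_v(f) = sup_x v(x) |f(x)|`. -/
noncomputable def supSeminorm (S : Submodule ℂ C(X, ℂ)) (v : Weight X) :
    Seminorm ℂ (weightedSubmodule S v) :=
  Seminorm.of (fun f => ⨆ x, v x * ‖f.1 x‖)
    (by
      intro f g
      refine Real.iSup_le (fun x => ?_) (add_nonneg ?_ ?_)
      · have h1 := le_ciSup f.2.2 x
        have h2 := le_ciSup g.2.2 x
        have h3 := mul_le_mul_of_nonneg_left (norm_add_le (f.1 x) (g.1 x)) (v.pos_toFun x).le
        have h4 : (f + g).1 x = f.1 x + g.1 x := rfl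
        rw [h4]
        linarith
      · exact Real.iSup_nonneg fun x => mul_nonneg (v.pos_toFun x).le (norm_nonneg _)
      · exact Real.iSup_nonneg fun x => mul_nonneg (v.pos_toFun x).le (norm_nonneg _))
    (by
      intro c f
      rw [Real.mul_iSup_of_nonneg (norm_nonneg c)]
      congr 1
      funext x
      have h4 : (c • f).1 x = c * f.1 x := rfl
      rw [h4, norm_mul]
      ring)

/-- The weighted space `{f ∈ S | p_v(f) < ∞}`, with the norm `p_v`. -/
def WeightedSpace (S : Submodule ℂ C(X, ℂ)) (v : Weight X) : Type _ := ↥(weightedSubmodule S v)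

noncomputable instance WeightedSpace.instNormedAddCommGroup (S : Submodule ℂ C(X, ℂ))
    (v : Weight X) : NormedAddCommGroup (WeightedSpace S v) :=
  AddGroupNorm.toNormedAddCommGroup (E := ↥(weightedSubmodule S v))
    { (supSeminorm S v).toAddGroupSeminorm with
      eq_zero_of_map_eq_zero' := by
        intro f hf
        ext x
        have h1 : v x * ‖f.1 x‖ ≤ 0 := (le_ciSup f.2.2 x).trans hf.le
        have h2 : ‖f.1 x‖ ≤ 0 := by
          by_contra h
          exact absurd h1 (not_le.2 (mul_pos (v.pos_toFun x) (not_le.1 h)))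
        exact norm_le_zero_iff.1 h2 }

noncomputable instance WeightedSpace.instModule (S : Submodule ℂ C(X, ℂ)) (v : Weight X) :
    Module ℂ (WeightedSpace S v) := inferInstanceAs (Module ℂ ↥(weightedSubmodule S v))

noncomputable instance WeightedSpace.instNormedSpace (S : Submodule ℂ C(X, ℂ)) (v : Weight X) :
    NormedSpace ℂ (WeightedSpace S v) where
  norm_smul_le c f := (map_smul_eq_mul (supSeminorm S v) c f).le

/-! ### Weight sequences, inductive limits and projective hulls -/

/-- A decreasing sequence of weights on `X`. -/
structure WeightSequence (X : Type*) [TopologicalSpace X] where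
  weight : ℕ+ → Weight X
  anti : ∀ ⦃k l : ℕ+⦄, k ≤ l → ∀ x, weight l x ≤ weight k x

namespace WeightSequence

theorem weightedSubmodule_mono (V : WeightSequence X) (S : Submodule ℂ C(X, ℂ)) {k l : ℕ+}
    (h : k ≤ l) : weightedSubmodule S (V.weight k) ≤ weightedSubmodule S (V.weight l) := by
  rintro f ⟨hf, a, ha⟩
  refine ⟨hf, a, ?_⟩
  rintro _ ⟨x, rfl⟩
  exact (mul_le_mul_of_nonneg_right (V.anti h x) (norm_nonneg _)).trans (ha (mem_range_self x))

/-- The union of the increasing sequence of the weighted spaces given by the weights `v_k`. -/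
def indSubmodule (V : WeightSequence X) (S : Submodule ℂ C(X, ℂ)) : Submodule ℂ C(X, ℂ) where
  carrier := {f | ∃ k, f ∈ weightedSubmodule S (V.weight k)}
  zero_mem' := ⟨1, Submodule.zero_mem _⟩
  add_mem' := by
    rintro f g ⟨k, hf⟩ ⟨l, hg⟩
    exact ⟨max k l, Submodule.add_mem _
      (V.weightedSubmodule_mono S (le_max_left k l) hf)
      (V.weightedSubmodule_mono S (le_max_right k l) hg)⟩
  smul_mem' := by
    rintro c f ⟨k, hf⟩
    exact ⟨k, Submodule.smul_mem _ c hf⟩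

/-- The underlying space of the inductive limit of the weighted spaces given by `v_k`. -/
def IndLimit (V : WeightSequence X) (S : Submodule ℂ C(X, ℂ)) : Type _ := ↥(V.indSubmodule S)

noncomputable instance (V : WeightSequence X) (S : Submodule ℂ C(X, ℂ)) :
    AddCommGroup (V.IndLimit S) := inferInstanceAs (AddCommGroup ↥(V.indSubmodule S))

noncomputable instance (V : WeightSequence X) (S : Submodule ℂ C(X, ℂ)) :
    Module ℂ (V.IndLimit S) := inferInstanceAs (Module ℂ ↥(V.indSubmodule S))

/-- The inclusion of the `k`-th weighted space in the inductive limit. -/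
def toIndLimit (V : WeightSequence X) (S : Submodule ℂ C(X, ℂ)) (k : ℕ+) :
    WeightedSpace S (V.weight k) → V.IndLimit S := fun f => ⟨f.1, k, f.2⟩

/-- The inductive limit topology: the finest locally convex vector space topology for which all
the inclusions of the weighted spaces are continuous. -/
noncomputable instance instTopologicalSpaceIndLimit (V : WeightSequence X)
    (S : Submodule ℂ C(X, ℂ)) : TopologicalSpace (V.IndLimit S) :=
  sInf {t : TopologicalSpace (V.IndLimit S) |
    (∀ k, @Continuous _ _ _ t (V.toIndLimit S k)) ∧
    @IsTopologicalAddGroup (V.IndLimit S) t _ ∧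
    @ContinuousSMul ℂ (V.IndLimit S) _ _ t ∧
    @LocallyConvexSpace ℝ (V.IndLimit S) _ _ _ _ t}

/-- The maximal system of weights `V̄` associated with `V`. -/
def hull (V : WeightSequence X) : Set (Weight X) :=
  {u | ∀ k, ∃ C : ℝ, 0 < C ∧ ∀ x, u x ≤ C * V.weight k x}

/-- The functions in `S` for which all the seminorms `p_u`, `u ∈ V̄`, are finite. -/
def projSubmodule (V : WeightSequence X) (S : Submodule ℂ C(X, ℂ)) : Submodule ℂ C(X, ℂ) where
  carrier := {f | f ∈ S ∧ ∀ u ∈ V.hull, f ∈ weightedSubmodule S u}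
  zero_mem' := ⟨S.zero_mem, fun _ _ => Submodule.zero_mem _⟩
  add_mem' hf hg :=
    ⟨S.add_mem hf.1 hg.1, fun u hu => Submodule.add_mem _ (hf.2 u hu) (hg.2 u hu)⟩
  smul_mem' c _ hf := ⟨S.smul_mem c hf.1, fun u hu => Submodule.smul_mem _ c (hf.2 u hu)⟩

/-- The underlying space of the projective hull. -/
def ProjHull (V : WeightSequence X) (S : Submodule ℂ C(X, ℂ)) : Type _ := ↥(V.projSubmodule S)

noncomputable instance (V : WeightSequence X) (S : Submodule ℂ C(X, ℂ)) :
    AddCommGroup (V.ProjHull S) := inferInstanceAs (AddCommGroup ↥(V.projSubmodule S))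

noncomputable instance (V : WeightSequence X) (S : Submodule ℂ C(X, ℂ)) :
    Module ℂ (V.ProjHull S) := inferInstanceAs (Module ℂ ↥(V.projSubmodule S))

/-- The seminorms `p_u(f) = sup_x u(x) |f(x)|`, `u ∈ V̄`, on the projective hull. -/
noncomputable def hullSeminorm (V : WeightSequence X) (S : Submodule ℂ C(X, ℂ)) :
    SeminormFamily ℂ (V.ProjHull S) V.hull := fun u =>
  (supSeminorm S u.1).comp (E := ↥(V.projSubmodule S))
    (Submodule.inclusion fun _ hf => hf.2 u.1 u.2)

/-- The topology on the projective hull generated by the seminorms `p_u`, `u ∈ V̄`. -/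
noncomputable instance instTopologicalSpaceProjHull (V : WeightSequence X)
    (S : Submodule ℂ C(X, ℂ)) : TopologicalSpace (V.ProjHull S) :=
  ⨅ u : V.hull, (V.hullSeminorm S u).toSeminormedAddCommGroup.toUniformSpace.toTopologicalSpace

/-- The condition `(M)` of Bierstedt and Meise: for every `k` and every `Y` which is not relatively
compact there is `k' > k` with `inf_Y v_{k'} / v_k = 0`. -/
def ConditionM (V : WeightSequence X) : Prop :=
  ∀ (k : ℕ+) (Y : Set X), ¬ IsCompact (closure Y) →
    ∃ k', k < k' ∧ IsGLB ((fun y => V.weight k' y / V.weight k y) '' Y) 0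

end WeightSequence

end Weighted

/-- The holomorphic functions on the open set `G`, as a space of continuous functions on `G`. -/
def holomorphicSubmodule {E : Type*} [NormedAddCommGroup E] [NormedSpace ℂ E] (G : Set E) :
    Submodule ℂ C(G, ℂ) where
  carrier := {f | ∃ F : E → ℂ, DifferentiableOn ℂ F G ∧ ∀ z : G, F z = f z}
  zero_mem' := ⟨fun _ => 0, differentiableOn_const 0, fun _ => rfl⟩
  add_mem' := by
    rintro f g ⟨F, hF, hf⟩ ⟨H, hH, hg⟩
    exact ⟨fun z => F z + H z, hF.add hH, fun z => by simp [hf, hg]⟩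
  smul_mem' := by
    rintro c f ⟨F, hF, hf⟩
    exact ⟨fun z => c • F z, hF.const_smul c, fun z => by simp [hf]⟩

section Spaces

variable {E : Type*} [NormedAddCommGroup E] [NormedSpace ℂ E] {G : Set E}

/-- The weighted inductive limit `𝒱C(G)` of spaces of continuous functions. -/
abbrev WeightSequence.IndC (V : WeightSequence G) : Type _ := V.IndLimit ⊤

/-- The projective hull `CV̄(G)`. -/
abbrev WeightSequence.ProjC (V : WeightSequence G) : Type _ := V.ProjHull ⊤

/-- The projective hull `HV̄(G)`. -/
abbrev WeightSequence.ProjH (V : WeightSequence G) : Type _ := V.ProjHull (holomorphicSubmodule G)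

end Spaces

/-! ### The angular weights -/

/-- `θ_n = 1 / (2 n)`. -/
noncomputable def theta (n : ℕ+) : ℝ := 1 / (2 * (n : ℝ))

/-- The left end of the interval `I_n`. -/
noncomputable def leftEnd (n : ℕ+) : ℝ := theta n - 1 / (2 ^ 5 * (n : ℝ) ^ 2)

/-- The right end of the interval `I_n`. -/
noncomputable def rightEnd (n : ℕ+) : ℝ := theta n + 1 / (2 ^ 5 * (n : ℝ) ^ 2)

/-- The point `θ_n + 1 / (2⁴ n²)`, between `I_n` and `I_{n-1}`, where the weights are `1`. -/
noncomputable def node (n : ℕ+) : ℝ := theta n + 1 / (2 ^ 4 * (n : ℝ) ^ 2)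

/-- On `[node (n + 1), node n]`: the function equal to `l n` on `I_n`, to `1` at both nodes, and
affine on the two remaining intervals. -/
noncomputable def angularPiece (l : ℕ+ → ℝ) (n : ℕ+) (θ : ℝ) : ℝ :=
  if θ ≤ leftEnd n then
    AffineMap.lineMap 1 (l n) ((θ - node (n + 1)) / (leftEnd n - node (n + 1)))
  else if θ ≤ rightEnd n then l n
  else AffineMap.lineMap (l n) 1 ((θ - rightEnd n) / (node n - rightEnd n))

open Classical in
/-- The function `ŵ` with value `l n` on `I_n`, and `1` at the nodes, at `0` and at `π`, which is
affine in between. -/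
noncomputable def angularWeight (l : ℕ+ → ℝ) (θ : ℝ) : ℝ :=
  if h : ∃ n : ℕ+, node (n + 1) < θ ∧ θ ≤ node n then angularPiece l h.choose θ else 1

theorem one_le_cast (n : ℕ+) : (1 : ℝ) ≤ n := by exact_mod_cast (one_le : 1 ≤ n)

theorem node_succ_lt_leftEnd (n : ℕ+) : node (n + 1) < leftEnd n := by
  have hn := one_le_cast n
  unfold node leftEnd theta
  push_cast
  rw [← sub_pos]
  have : 1 / (2 * (n : ℝ)) - 1 / (2 ^ 5 * (n : ℝ) ^ 2)
      - (1 / (2 * ((n : ℝ) + 1)) + 1 / (2 ^ 4 * ((n : ℝ) + 1) ^ 2))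
      = (16 * n * (n + 1) - (n + 1) ^ 2 - 2 * n ^ 2) / (32 * (n : ℝ) ^ 2 * ((n : ℝ) + 1) ^ 2) := by
    field_simp
    ring
  rw [this]
  apply div_pos
  · nlinarith
  · positivity

theorem leftEnd_lt_rightEnd (n : ℕ+) : leftEnd n < rightEnd n := by
  have hn := one_le_cast n
  have : 0 < 1 / (2 ^ 5 * (n : ℝ) ^ 2) := by positivity
  unfold leftEnd rightEnd
  linarith

theorem rightEnd_lt_node (n : ℕ+) : rightEnd n < node n := by
  have hn := one_le_cast n
  have h : 0 < 1 / (2 ^ 5 * (n : ℝ) ^ 2) := by positivity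
  have h2 : 1 / (2 ^ 4 * (n : ℝ) ^ 2) = 2 * (1 / (2 ^ 5 * (n : ℝ) ^ 2)) := by
    field_simp
  unfold node rightEnd
  linarith

theorem node_anti {m n : ℕ+} (h : m ≤ n) : node n ≤ node m := by
  have hm := one_le_cast m
  have h' : (m : ℝ) ≤ n := by exact_mod_cast h
  unfold node theta
  gcongr

theorem angularWeight_eq (l : ℕ+ → ℝ) {n : ℕ+} {θ : ℝ} (h1 : node (n + 1) < θ) (h2 : θ ≤ node n) :
    angularWeight l θ = angularPiece l n θ := by
  have h : ∃ n : ℕ+, node (n + 1) < θ ∧ θ ≤ node n := ⟨n, h1, h2⟩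
  have key : h.choose = n := by
    obtain ⟨h3, h4⟩ := h.choose_spec
    rcases lt_trichotomy h.choose n with hlt | heq | hgt
    · exact absurd (node_anti (PNat.add_one_le_iff.2 hlt)) (not_le.2 (h3.trans_le h2))
    · exact heq
    · exact absurd (node_anti (PNat.add_one_le_iff.2 hgt)) (not_le.2 (h1.trans_le h4))
  rw [angularWeight, dif_pos h, key]

theorem angularPiece_eq_of_mem (l : ℕ+ → ℝ) {n : ℕ+} {θ : ℝ}
    (h : θ ∈ Icc (leftEnd n) (rightEnd n)) : angularPiece l n θ = l n := by
  unfold angularPiece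
  split_ifs with h1 h2
  · have : θ = leftEnd n := le_antisymm h1 h.1
    subst this
    rw [div_self (sub_pos.2 (node_succ_lt_leftEnd n)).ne', AffineMap.lineMap_apply_one]
  · rfl
  · exact absurd h.2 h2

/-- The value on `I_n`. -/
theorem angularWeight_eq_of_mem (l : ℕ+ → ℝ) {n : ℕ+} {θ : ℝ}
    (h : θ ∈ Icc (leftEnd n) (rightEnd n)) : angularWeight l θ = l n := by
  rw [angularWeight_eq l ((node_succ_lt_leftEnd n).trans_le h.1)
    (h.2.trans (rightEnd_lt_node n).le), angularPiece_eq_of_mem l h]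

theorem angularPiece_node (l : ℕ+ → ℝ) (n : ℕ+) : angularPiece l n (node n) = 1 := by
  have h1 := leftEnd_lt_rightEnd n
  have h2 := rightEnd_lt_node n
  rw [angularPiece, if_neg (by linarith), if_neg (by linarith),
    div_self (sub_pos.2 h2).ne', AffineMap.lineMap_apply_one]

theorem angularPiece_node_succ (l : ℕ+ → ℝ) (n : ℕ+) : angularPiece l n (node (n + 1)) = 1 := by
  rw [angularPiece, if_pos (node_succ_lt_leftEnd n).le, sub_self, zero_div,
    AffineMap.lineMap_apply_zero]

theorem angularWeight_node (l : ℕ+ → ℝ) (n : ℕ+) : angularWeight l (node n) = 1 := by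
  rw [angularWeight_eq l ((node_succ_lt_leftEnd n).trans
    ((leftEnd_lt_rightEnd n).trans (rightEnd_lt_node n))) le_rfl, angularPiece_node]

theorem angularWeight_of_le (l : ℕ+ → ℝ) {θ : ℝ} (h : node 1 ≤ θ) : angularWeight l θ = 1 := by
  rcases h.eq_or_lt with rfl | h
  · exact angularWeight_node l 1
  · rw [angularWeight, dif_neg]
    rintro ⟨n, -, hn⟩
    exact absurd (hn.trans (node_anti (one_le : 1 ≤ n))) (not_le.2 h)

theorem continuous_angularPiece (l : ℕ+ → ℝ) (n : ℕ+) : Continuous (angularPiece l n) := by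
  have h1 := node_succ_lt_leftEnd n
  have h2 := leftEnd_lt_rightEnd n
  have h3 := rightEnd_lt_node n
  unfold angularPiece
  simp only [AffineMap.lineMap_apply_ring']
  refine Continuous.if_le (by fun_prop) (Continuous.if_le (by fun_prop) (by fun_prop)
    continuous_id continuous_const ?_) continuous_id continuous_const ?_
  · rintro θ rfl
    simp
  · rintro θ rfl
    rw [if_pos h2.le, div_self (sub_pos.2 h1).ne']
    ring

/-- A convex combination of `1` and `l n` with coefficients which do not depend on `l`. -/
theorem exists_angularWeight_eq (θ : ℝ) : ∃ (n : ℕ+) (s : ℝ), 0 ≤ s ∧ s ≤ 1 ∧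
    ∀ l : ℕ+ → ℝ, angularWeight l θ = (1 - s) + s * l n := by
  by_cases h : ∃ n : ℕ+, node (n + 1) < θ ∧ θ ≤ node n
  · obtain ⟨n, h1, h2⟩ := h
    have h3 := node_succ_lt_leftEnd n
    have h5 := rightEnd_lt_node n
    refine ⟨n, ?_⟩
    by_cases h6 : θ ≤ leftEnd n
    · refine ⟨(θ - node (n + 1)) / (leftEnd n - node (n + 1)), div_nonneg (by linarith)
        (by linarith), div_le_one_of_le₀ (by linarith) (by linarith), fun l => ?_⟩
      rw [angularWeight_eq l h1 h2, angularPiece, if_pos h6, AffineMap.lineMap_apply_ring']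
      ring
    · by_cases h7 : θ ≤ rightEnd n
      · refine ⟨1, by norm_num, le_rfl, fun l => ?_⟩
        rw [angularWeight_eq l h1 h2, angularPiece, if_neg h6, if_pos h7]
        ring
      · refine ⟨1 - (θ - rightEnd n) / (node n - rightEnd n), ?_, ?_, fun l => ?_⟩
        · rw [sub_nonneg]
          exact div_le_one_of_le₀ (by linarith) (by linarith)
        · rw [sub_le_self_iff]
          exact div_nonneg (by linarith) (by linarith)
        · rw [angularWeight_eq l h1 h2, angularPiece, if_neg h6, if_neg h7,
            AffineMap.lineMap_apply_ring']
          ring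
  · exact ⟨1, 0, le_rfl, zero_le_one, fun l => by rw [angularWeight, dif_neg h]; ring⟩

theorem angularWeight_pos {l : ℕ+ → ℝ} (hl : ∀ n, 0 < l n) (θ : ℝ) : 0 < angularWeight l θ := by
  obtain ⟨n, s, h0, h1, h⟩ := exists_angularWeight_eq θ
  rw [h]
  rcases h1.eq_or_lt with rfl | h1
  · simpa using hl n
  · have := mul_nonneg h0 (hl n).le
    linarith

theorem angularWeight_mono {l l' : ℕ+ → ℝ} (hl : ∀ n, l n ≤ l' n) (θ : ℝ) :
    angularWeight l θ ≤ angularWeight l' θ := by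
  obtain ⟨n, s, h0, h1, h⟩ := exists_angularWeight_eq θ
  rw [h, h]
  have := mul_le_mul_of_nonneg_left (hl n) h0
  linarith

theorem continuousOn_angularWeight (l : ℕ+ → ℝ) : ContinuousOn (angularWeight l) (Ioi 0) := by
  have key : ∀ n : ℕ+, ContinuousOn (angularWeight l) (Ici (node n)) := by
    intro n
    induction n using PNat.recOn with
    | one => exact continuousOn_const.congr fun θ hθ => angularWeight_of_le l hθ
    | succ n ih =>
      rw [← Icc_union_Ici_eq_Ici (node_anti (PNat.lt_add_right n 1).le)]
      refine ContinuousOn.union_of_isClosed ?_ ih isClosed_Icc isClosed_Ici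
      refine (continuous_angularPiece l n).continuousOn.congr fun θ hθ => ?_
      rcases hθ.1.eq_or_lt with rfl | h
      · rw [angularWeight_node, angularPiece_node_succ]
      · exact angularWeight_eq l h hθ.2
  intro θ hθ
  obtain ⟨n, hn⟩ : ∃ n : ℕ+, node n < θ := by
    obtain ⟨m, hm⟩ := exists_nat_gt (1 / θ)
    refine ⟨m.succPNat, ?_⟩
    have h1 : (1 : ℝ) ≤ (m.succPNat : ℕ) := one_le_cast _
    have h2 : 1 / θ < ((m.succPNat : ℕ) : ℝ) := by
      refine hm.trans ?_
      simp
    set x : ℝ := ((m.succPNat : ℕ) : ℝ)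
    have h3 : 1 < x * θ := by
      rwa [div_lt_iff₀ hθ] at h2
    have h4 : 1 / x < θ := by
      rw [div_lt_iff₀ (by linarith)]
      linarith
    have h5 : node m.succPNat ≤ 1 / x := by
      change 1 / (2 * x) + 1 / (2 ^ 4 * x ^ 2) ≤ 1 / x
      have h6 : 1 / x - (1 / (2 * x) + 1 / (2 ^ 4 * x ^ 2)) = (8 * x - 1) / (16 * x ^ 2) := by
        field_simp
        ring
      have h7 : 0 ≤ (8 * x - 1) / (16 * x ^ 2) := div_nonneg (by linarith) (by positivity)
      linarith
    linarith
  exact ((key n).continuousAt (Ici_mem_nhds hn)).continuousWithinAt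

/-! ### The domain and the weights `v_k` -/

/-- `G₁ = {z | 1/2 < |z| < 1, 0 < arg z < π}`. -/
def G₁ : Set ℂ := {z | 1 / 2 < ‖z‖ ∧ ‖z‖ < 1 ∧ 0 < z.arg ∧ z.arg < Real.pi}

/-- The distance of `z` to the complement of `G₁`. -/
noncomputable def distCompl (z : ℂ) : ℝ := Metric.infDist z G₁ᶜ

/-- The exponent `(k - 1) / (2 k)`. -/
noncomputable def expo (k : ℕ+) : ℝ := ((k : ℝ) - 1) / (2 * (k : ℝ))

/-- The function `u_k`. -/
noncomputable def uFun (k : ℕ+) (z : ℂ) (t : ℝ) : ℝ :=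
  if t ≤ k then (1 + 1 / distCompl z + t) ^ (-expo k)
  else if t ≤ k + 1 then
    AffineMap.lineMap ((1 + 1 / distCompl z + (k : ℝ)) ^ (-expo k))
      ((1 + ((k : ℝ) + 1)) ^ (-expo k)) (t - k)
  else (1 + t) ^ (-expo k)

theorem mem_G₁_iff (z : ℂ) : z ∈ G₁ ↔ 1 / 2 < ‖z‖ ∧ ‖z‖ < 1 ∧ 0 < z.im := by
  have key : 0 < z.im ↔ 0 < z.arg ∧ z.arg < Real.pi := by
    constructor
    · intro h
      refine ⟨lt_of_le_of_ne (Complex.arg_nonneg_iff.2 h.le) fun h0 => ?_,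
        Complex.arg_lt_pi_iff.2 (Or.inr h.ne')⟩
      have := (Complex.arg_eq_zero_iff.1 h0.symm).2
      linarith
    · rintro ⟨h0, h1⟩
      refine lt_of_le_of_ne (Complex.arg_nonneg_iff.1 h0.le) fun h => ?_
      rcases le_or_gt 0 z.re with hr | hr
      · exact h0.ne' (Complex.arg_eq_zero_iff.2 ⟨hr, h.symm⟩)
      · exact h1.ne (Complex.arg_eq_pi_iff.2 ⟨hr, h.symm⟩)
  unfold G₁
  rw [mem_ofPred_eq, key]

theorem isOpen_G₁ : IsOpen G₁ := by
  have : G₁ = {z : ℂ | 1 / 2 < ‖z‖} ∩ ({z : ℂ | ‖z‖ < 1} ∩ {z : ℂ | 0 < z.im}) := by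
    ext z
    exact mem_G₁_iff z
  rw [this]
  exact (isOpen_lt continuous_const continuous_norm).inter
    ((isOpen_lt continuous_norm continuous_const).inter
      (isOpen_lt continuous_const Complex.continuous_im))

theorem zero_mem_compl_G₁ : (0 : ℂ) ∈ G₁ᶜ := fun h => by
  have := ((mem_G₁_iff 0).1 h).2.2
  simp at this

theorem distCompl_pos {z : ℂ} (hz : z ∈ G₁) : 0 < distCompl z :=
  (isOpen_G₁.isClosed_compl.notMem_iff_infDist_pos ⟨0, zero_mem_compl_G₁⟩).1 fun h => h hz

theorem one_le_inv_distCompl {z : ℂ} (hz : z ∈ G₁) : 1 ≤ 1 / distCompl z := by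
  rw [le_div_iff₀ (distCompl_pos hz), one_mul]
  have h := Metric.infDist_le_dist_of_mem (x := z) zero_mem_compl_G₁
  rw [dist_zero_right] at h
  exact h.trans hz.2.1.le

theorem expo_nonneg (k : ℕ+) : 0 ≤ expo k := by
  have := one_le_cast k
  exact div_nonneg (by linarith) (by linarith)

theorem expo_mono {k l : ℕ+} (h : k ≤ l) : expo k ≤ expo l := by
  have hk := one_le_cast k
  have h' : (k : ℝ) ≤ l := by exact_mod_cast h
  unfold expo
  rw [div_le_div_iff₀ (by linarith) (by linarith)]
  nlinarith

theorem le_uFun (k : ℕ+) {z : ℂ} (hz : z ∈ G₁) {t : ℝ} (ht : 0 ≤ t) :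
    (1 + 1 / distCompl z + t) ^ (-expo k) ≤ uFun k z t := by
  have hk := one_le_cast k
  have hd := one_le_inv_distCompl hz
  have he : -expo k ≤ 0 := neg_nonpos.2 (expo_nonneg k)
  unfold uFun
  split_ifs with h1 h2
  · exact le_rfl
  · have hA := Real.rpow_le_rpow_of_nonpos (x := 1 + 1 / distCompl z + (k : ℝ))
      (y := 1 + 1 / distCompl z + t) (by linarith) (by linarith) he
    have hAB := Real.rpow_le_rpow_of_nonpos (x := 1 + ((k : ℝ) + 1))
      (y := 1 + 1 / distCompl z + (k : ℝ)) (by linarith) (by linarith) he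
    rw [AffineMap.lineMap_apply_ring']
    have := mul_nonneg (show 0 ≤ t - k by linarith) (sub_nonneg.2 hAB)
    linarith
  · exact Real.rpow_le_rpow_of_nonpos (by linarith) (by linarith) he

theorem uFun_le (k : ℕ+) {z : ℂ} (hz : z ∈ G₁) {t : ℝ} (_ht : 0 ≤ t) :
    uFun k z t ≤ (1 + t) ^ (-expo k) := by
  have hk := one_le_cast k
  have hd := one_le_inv_distCompl hz
  have he : -expo k ≤ 0 := neg_nonpos.2 (expo_nonneg k)
  unfold uFun
  split_ifs with h1 h2
  · exact Real.rpow_le_rpow_of_nonpos (by linarith) (by linarith) he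
  · have hA := Real.rpow_le_rpow_of_nonpos (x := 1 + t)
      (y := 1 + ((k : ℝ) + 1)) (by linarith) (by linarith) he
    have hAB := Real.rpow_le_rpow_of_nonpos (x := 1 + ((k : ℝ) + 1))
      (y := 1 + 1 / distCompl z + (k : ℝ)) (by linarith) (by linarith) he
    rw [AffineMap.lineMap_apply_ring']
    have := mul_nonneg (show 0 ≤ 1 - (t - k) by linarith) (sub_nonneg.2 hAB)
    linarith
  · exact le_rfl

theorem uFun_pos (k : ℕ+) {z : ℂ} (hz : z ∈ G₁) {t : ℝ} (ht : 0 ≤ t) : 0 < uFun k z t :=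
  (Real.rpow_pos_of_pos (by have := one_le_inv_distCompl hz; linarith) _).trans_le
    (le_uFun k hz ht)

theorem uFun_anti {k l : ℕ+} (h : k ≤ l) {z : ℂ} (hz : z ∈ G₁) {t : ℝ} (ht : 0 ≤ t) :
    uFun l z t ≤ uFun k z t := by
  have hd := one_le_inv_distCompl hz
  have he := neg_le_neg (expo_mono h)
  rcases h.eq_or_lt with rfl | hlt
  · exact le_rfl
  rcases le_or_gt t l with h1 | h1
  · refine le_trans ?_ (le_uFun k hz ht)
    rw [uFun, if_pos h1]
    exact Real.rpow_le_rpow_of_exponent_le (by linarith) he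
  · have hkl : (k : ℝ) + 1 ≤ l := by exact_mod_cast PNat.add_one_le_iff.2 hlt
    have h2 : uFun k z t = (1 + t) ^ (-expo k) := by
      rw [uFun, if_neg (by linarith), if_neg (by linarith)]
    rw [h2]
    exact (uFun_le l hz ht).trans (Real.rpow_le_rpow_of_exponent_le (by linarith) he)

/-- The domain `G = G₁ × ℂ` in `ℂ²`. -/
def Gset : Set (ℂ × ℂ) := G₁ ×ˢ univ

theorem continuous_uFun (k : ℕ+) : Continuous fun z : Gset => uFun k z.1.1 ‖z.1.2‖ := by
  have hk := one_le_cast k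
  have hdc : Continuous fun z : Gset => 1 / distCompl z.1.1 := by
    refine continuous_const.div ((Metric.continuous_infDist_pt _).comp (by fun_prop)) ?_
    intro z
    exact (distCompl_pos z.2.1).ne'
  have hd : ∀ z : Gset, 1 ≤ 1 / distCompl z.1.1 := fun z => one_le_inv_distCompl z.2.1
  have ht : Continuous fun z : Gset => ‖z.1.2‖ := by fun_prop
  unfold uFun
  simp only [AffineMap.lineMap_apply_ring']
  refine Continuous.if_le ?_ (Continuous.if_le ?_ ?_ ht continuous_const ?_) ht
    continuous_const ?_
  · refine Continuous.rpow_const (by fun_prop) fun z => Or.inl ?_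
    have := hd z
    have := norm_nonneg z.1.2
    linarith
  · have h1 : Continuous fun z : Gset => (1 + 1 / distCompl z.1.1 + (k : ℝ)) ^ (-expo k) := by
      refine Continuous.rpow_const (by fun_prop) fun z => Or.inl ?_
      have := hd z
      linarith
    fun_prop
  · refine Continuous.rpow_const (by fun_prop) fun z => Or.inl ?_
    have := norm_nonneg z.1.2
    linarith
  · intro z hz
    rw [hz]
    ring
  · intro z hz
    rw [hz, if_pos (by linarith)]
    ring

theorem continuous_wFun (l : ℕ+ → ℝ) : Continuous fun z : Gset => angularWeight l z.1.1.arg := by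
  rw [continuous_iff_continuousAt]
  intro z
  have h1 : ContinuousAt Complex.arg z.1.1 :=
    Complex.continuousAt_arg (Or.inr ((mem_G₁_iff _).1 z.2.1).2.2.ne')
  have h2 : ContinuousAt (angularWeight l) z.1.1.arg :=
    (continuousOn_angularWeight l).continuousAt (Ioi_mem_nhds z.2.1.2.2.1)
  have h3 : ContinuousAt (fun z : Gset => z.1.1) z := by fun_prop
  have h4 : ContinuousAt (fun z : Gset => z.1.1.arg) z :=
    ContinuousAt.comp (g := Complex.arg) (f := fun z : Gset => z.1.1) h1 h3
  exact ContinuousAt.comp (g := angularWeight l) (f := fun z : Gset => z.1.1.arg) h2 h4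

/-- An admissible matrix `λ_{nk}`: decreasing in `k`, with `1 / n² ≤ λ_{nk} ≤ 1`. -/
structure AdmissibleMatrix where
  coeff : ℕ+ → ℕ+ → ℝ
  lower : ∀ n k : ℕ+, 1 / (n : ℝ) ^ 2 ≤ coeff n k
  upper : ∀ n k : ℕ+, coeff n k ≤ 1
  anti : ∀ n : ℕ+, Antitone (coeff n)

namespace AdmissibleMatrix

theorem coeff_pos (Λ : AdmissibleMatrix) (n k : ℕ+) : 0 < Λ.coeff n k := by
  have := one_le_cast n
  exact lt_of_lt_of_le (by positivity) (Λ.lower n k)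

/-- The weight `w_k(r e^{iθ}) = ŵ_k(θ)`. -/
noncomputable def wFun (Λ : AdmissibleMatrix) (k : ℕ+) (z : ℂ) : ℝ :=
  angularWeight (fun n => Λ.coeff n k) z.arg

/-- The sequence of the weights `v_k(z₁, z₂) = w_k(z₁) u_k(z₁, |z₂|)` on `G = G₁ × ℂ`. -/
noncomputable def weightSequence (Λ : AdmissibleMatrix) : WeightSequence Gset where
  weight k :=
    { toFun := fun z => Λ.wFun k z.1.1 * uFun k z.1.1 ‖z.1.2‖
      continuous_toFun := (continuous_wFun _).mul (continuous_uFun k)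
      pos_toFun := fun z => mul_pos (angularWeight_pos (fun n => Λ.coeff_pos n k) _)
        (uFun_pos k z.2.1 (norm_nonneg _)) }
  anti := fun k l h z => mul_le_mul (angularWeight_mono (fun n => Λ.anti n h) _)
    (uFun_anti h z.2.1 (norm_nonneg _)) (uFun_pos l z.2.1 (norm_nonneg _)).le
    (angularWeight_pos (fun n => Λ.coeff_pos n k) _).le

end AdmissibleMatrix

/-!
Write `B_m(M)` for the set of continuous `f` with `v_m |f| ≤ M`. Everything rests on two facts about
a decreasing sequence `V` of weights on a locally compact, σ-compact space.

* The hull `V̄` is rich (`WeightSequence.exists_hull_weight`): for any constants one finds larger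
  ones `D_k` for which the infimum of the `D_k v_k` is locally a minimum of finitely many of these
  weights, hence an element of `V̄`. If a family of functions is unbounded for every `p_{v_k}`, such
  a weight can be kept large along a sequence of witnesses, so a family bounded for all seminorms of
  the projective hull lies in some `B_m(M)` (`WeightSequence.exists_weight_bound`). This gives the
  algebraic equality.

* Condition `(M)` has a finite form (`WeightSequence.ConditionM.exists_compact`): for any `δ_k > 0`
  there are `N` and a compact set off which one of the inequalities `v_k < δ_k v_m`, `k ≤ N`, holds.
  Otherwise a diagonal choice of points escaping to infinity would violate `(M)`.

Consequently the topology of the projective hull on `B_m(M)` is that of uniform convergence on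
compact sets: off a compact set, `f ∈ B_m(M)` has `v_k |f| ≤ δ_k M` for some `k ≤ N`, so every
`p_u` is small there. Therefore bounded sets are metrizable, and bounded sets of holomorphic
functions are relatively compact by the Schwarz lemma and the Arzelà–Ascoli theorem.

For the topological equality, let `U` be a convex neighbourhood of zero containing the balls of
radius `ε_k` of the steps, and let `a_k > 0` have sum less than `1`. For a suitable `u ∈ V̄`, every
`f` with `p_u(f) ≤ 1` satisfies `|f| ≤ max_{k ≤ N} a_k ε_k / v_k` for some `N` depending on `f`: on
a compact set because `u` is a finite minimum there, off it by the finite form of `(M)`. Splitting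
`f` in proportion to these finitely many functions writes it as a convex combination of `0` and
elements of `U`.

For the weights `v_k(z₁, z₂) = w_k(z₁) u_k(z₁, |z₂|)` condition `(M)` holds because of the second
factor, the quotients `w_l / w_k`, `k ≤ l`, being at most `1`: the exponents `(k - 1) / (2 k)` are strictly increasing, so `u_l / u_k` tends to zero
if `|z₂|` tends to infinity, and if `|z₂| ≤ l` and `z₁` tends to the boundary of `G₁`.
-/

namespace WeightSequence

/-! ### Weights in the hull and the finite form of condition `(M)` -/

section General

open Filter

variable {X : Type*} [TopologicalSpace X]

/-- For `D` growing fast enough, the infimum `u` of the weights `D k * v k` belongs to `V̄`, and on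
a compact set only finitely many of them matter. The constants `D` can be chosen above any given
`C`. -/
theorem exists_hull_weight (V : WeightSequence X) (K : CompactExhaustion X) (C : ℕ+ → ℝ) :
    ∃ (D : ℕ+ → ℝ) (u : Weight X), (∀ k, C k ≤ D k) ∧ (∀ k, 1 ≤ D k) ∧ u ∈ V.hull ∧
      (∀ k x, u x ≤ D k * V.weight k x) ∧
      ∀ L, IsCompact L → ∃ N : ℕ+, ∀ x ∈ L, ∃ k ≤ N, u x = D k * V.weight k x := by
  have hD : ∀ j : ℕ+, ∃ d : ℝ, C j ≤ d ∧ 1 ≤ d ∧ (j = 1 → d = max (C 1) 1) ∧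
      ∀ x ∈ K j, max (C 1) 1 * V.weight 1 x ≤ d * V.weight j x := by
    intro j
    by_cases hj : j = 1
    · subst hj
      exact ⟨max (C 1) 1, le_max_left _ _, le_max_right _ _, fun _ => rfl, fun _ _ => le_rfl⟩
    · have hcont : Continuous fun x => max (C 1) 1 * V.weight 1 x / V.weight j x :=
        (continuous_const.mul (V.weight 1).continuous_toFun).div (V.weight j).continuous_toFun
          fun x => ((V.weight j).pos_toFun x).ne'
      obtain ⟨b, hb⟩ := (K.isCompact j).bddAbove_image hcont.continuousOn
      refine ⟨max (max (C j) 1) b, (le_max_left _ _).trans (le_max_left _ _),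
        (le_max_right _ _).trans (le_max_left _ _), fun h => absurd h hj, fun x hx => ?_⟩
      have h1 := hb (mem_image_of_mem _ hx)
      rw [← div_le_iff₀ ((V.weight j).pos_toFun x)]
      exact h1.trans (le_max_right _ _)
  choose D hCD h1D hD1 hDK using hD
  have hbdd : ∀ x, BddBelow (range fun k => D k * V.weight k x) := fun x =>
    ⟨0, by
      rintro _ ⟨k, rfl⟩
      exact mul_nonneg (zero_le_one.trans (h1D k)) ((V.weight k).pos_toFun x).le⟩
  have hne : ∀ N : ℕ+, (Finset.Icc 1 N).Nonempty := fun N => ⟨1, by simp⟩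
  -- The choice of `D` makes `D j * v j` at least `D 1 * v 1` on `K n` for `j ≥ n`, so that only
  -- finitely many weights matter for the infimum there.
  have hfin : ∀ (n : ℕ) (N : ℕ+), n ≤ N → ∀ x ∈ K n, (⨅ k, D k * V.weight k x) =
      (Finset.Icc 1 N).inf' (hne N) fun k => D k * V.weight k x := by
    intro n N hN x hx
    refine le_antisymm (Finset.le_inf' _ _ fun k _ => ciInf_le (hbdd x) k) (le_ciInf fun j => ?_)
    by_cases hj : j ≤ N
    · exact Finset.inf'_le (fun k => D k * V.weight k x) (Finset.mem_Icc.2 ⟨one_le, hj⟩)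
    · have hnj : n ≤ (j : ℕ) := hN.trans (by exact_mod_cast (not_le.1 hj).le)
      refine (Finset.inf'_le (fun k => D k * V.weight k x)
        (Finset.mem_Icc.2 ⟨le_rfl, one_le⟩ : (1 : ℕ+) ∈ Finset.Icc 1 N)).trans ?_
      rw [hD1 1 rfl]
      exact hDK j x (K.subset hnj hx)
  have hatt : ∀ (n : ℕ) (N : ℕ+), n ≤ N → ∀ x ∈ K n, ∃ k ≤ N,
      (⨅ k, D k * V.weight k x) = D k * V.weight k x := by
    intro n N hN x hx
    obtain ⟨k, hk, he⟩ := Finset.exists_mem_eq_inf' (hne N) fun k => D k * V.weight k x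
    exact ⟨k, (Finset.mem_Icc.1 hk).2, (hfin n N hN x hx).trans he⟩
  have hle : ∀ n : ℕ, n ≤ (n.succPNat : ℕ) := fun n => by simp
  let u : Weight X :=
    { toFun := fun x => ⨅ k, D k * V.weight k x
      continuous_toFun := by
        rw [continuous_iff_continuousAt]
        intro x
        obtain ⟨n, hn⟩ := K.exists_mem_nhds x
        have hc : Continuous fun x => (Finset.Icc 1 n.succPNat).inf' (hne _)
            fun k => D k * V.weight k x :=
          Continuous.finset_inf'_apply _ fun k _ =>
            continuous_const.mul (V.weight k).continuous_toFun
        refine hc.continuousAt.congr ?_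
        filter_upwards [hn] with y hy
        exact (hfin n _ (hle n) y hy).symm
      pos_toFun := fun x => by
        obtain ⟨n, hn⟩ := K.exists_mem x
        obtain ⟨k, -, hk⟩ := hatt n _ (hle n) x hn
        rw [hk]
        exact mul_pos (zero_lt_one.trans_le (h1D k)) ((V.weight k).pos_toFun x) }
  have hu : ∀ k x, u x ≤ D k * V.weight k x := fun k x => ciInf_le (hbdd x) k
  refine ⟨D, u, hCD, h1D, fun k => ⟨D k, zero_lt_one.trans_le (h1D k), hu k⟩, hu, fun L hL => ?_⟩
  obtain ⟨n, hn⟩ := K.exists_superset_of_isCompact hL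
  exact ⟨n.succPNat, fun x hx => hatt n _ (hle n) x (hn hx)⟩

theorem hull_nonempty (V : WeightSequence X) (K : CompactExhaustion X) : V.hull.Nonempty := by
  obtain ⟨-, u, -, -, hu, -⟩ := V.exists_hull_weight K 1
  exact ⟨u, hu⟩

/-- A family of functions which is bounded for every `p_u`, `u ∈ V̄`, is bounded for some
`p_{v_k}`. -/
theorem exists_weight_bound (V : WeightSequence X) (K : CompactExhaustion X)
    (B : Set C(X, ℂ)) (hB : ∀ u ∈ V.hull, ∃ M : ℝ, ∀ f ∈ B, ∀ x, u x * ‖f x‖ ≤ M) :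
    ∃ (k : ℕ+) (M : ℝ), 0 < M ∧ ∀ f ∈ B, ∀ x, V.weight k x * ‖f x‖ ≤ M := by
  by_contra! hcon
  have hcon' : ∀ k : ℕ+, ∃ f ∈ B, ∃ x, (k : ℝ) < V.weight k x * ‖f x‖ := fun k =>
    hcon k k (by have := one_le_cast k; linarith)
  choose f hf x hx using hcon'
  -- The constants are so large that `C j * v j ≥ v k` at `x k` for all `k < j`.
  obtain ⟨D, u, hCD, h1D, hu, -, hatt⟩ := V.exists_hull_weight K fun j =>
    ∑ k ∈ Finset.Icc 1 j, V.weight k (x k) / V.weight j (x k)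
  have key : ∀ k, V.weight k (x k) ≤ u (x k) := by
    intro k
    obtain ⟨_, h⟩ := hatt {x k} isCompact_singleton
    obtain ⟨j, -, hj⟩ := h (x k) rfl
    rw [hj]
    have hpos := (V.weight j).pos_toFun (x k)
    rcases le_total j k with hjk | hkj
    · exact (V.anti hjk _).trans (le_mul_of_one_le_left hpos.le (h1D j))
    · rw [← div_le_iff₀ hpos]
      refine le_trans ?_ (hCD j)
      exact Finset.single_le_sum (f := fun k => V.weight k (x k) / V.weight j (x k))
        (fun i _ => div_nonneg ((V.weight i).pos_toFun _).le ((V.weight j).pos_toFun _).le)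
        (Finset.mem_Icc.2 ⟨one_le, hkj⟩)
  obtain ⟨M, hM⟩ := hB u hu
  obtain ⟨n, hn⟩ := exists_nat_gt M
  have h1 := hM (f n.succPNat) (hf _) (x n.succPNat)
  have h2 := mul_le_mul_of_nonneg_right (key n.succPNat)
    (norm_nonneg (f n.succPNat (x n.succPNat)))
  have h3 := hx n.succPNat
  have h4 : ((n.succPNat : ℕ) : ℝ) = n + 1 := by simp
  linarith

/-- The finite form of condition `(M)`: off a compact set, one of finitely many weights is small
compared with `v_m`. -/
theorem ConditionM.exists_compact {V : WeightSequence X} (hV : V.ConditionM)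
    (K : CompactExhaustion X) (m : ℕ+) {δ : ℕ+ → ℝ} (hδ : ∀ k, 0 < δ k) :
    ∃ (N : ℕ+) (L : Set X), IsCompact L ∧
      ∀ x ∉ L, ∃ k ≤ N, V.weight k x < δ k * V.weight m x := by
  by_contra! hcon
  -- The points `y n` leave every compact set, while `v k / v m ≥ δ k` at `y n` for `k ≤ n + 1`.
  choose y hyK hy using fun n : ℕ => hcon n.succPNat (K n) (K.isCompact n)
  have hY : ¬ IsCompact (closure (range y)) := by
    intro h
    obtain ⟨n, hn⟩ := K.exists_superset_of_isCompact h
    exact hyK n (hn (subset_closure (mem_range_self n)))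
  obtain ⟨k, -, hk⟩ := hV m _ hY
  have hpos : ∀ n, 0 < V.weight k (y n) / V.weight m (y n) := fun n =>
    div_pos ((V.weight k).pos_toFun _) ((V.weight m).pos_toFun _)
  obtain ⟨n₀, -, hn₀⟩ := (Finset.range (k + 1)).exists_min_image
    (fun n => V.weight k (y n) / V.weight m (y n)) ⟨0, by simp⟩
  have hlow : min (δ k) (V.weight k (y n₀) / V.weight m (y n₀)) ≤ 0 := by
    refine hk.2 ?_
    rintro _ ⟨_, ⟨n, rfl⟩, rfl⟩
    by_cases hn : n ∈ Finset.range (k + 1)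
    · exact (min_le_right _ _).trans (hn₀ n hn)
    · refine (min_le_left _ _).trans ?_
      rw [le_div_iff₀ ((V.weight m).pos_toFun _)]
      refine hy n k ?_
      rw [← PNat.coe_le_coe, Nat.succPNat_coe]
      have := Finset.mem_range.not.1 hn
      omega
  exact absurd hlow (not_le.2 (lt_min (hδ k) (hpos n₀)))


/-! ### The topology of the projective hull -/

theorem withSeminorms_hullSeminorm (V : WeightSequence X) (S : Submodule ℂ C(X, ℂ)) :
    WithSeminorms (V.hullSeminorm S) := by
  have : IsTopologicalAddGroup (V.ProjHull S) := topologicalAddGroup_iInf fun u =>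
    letI := (V.hullSeminorm S u).toSeminormedAddCommGroup
    inferInstance
  exact (SeminormFamily.withSeminorms_iff_topologicalSpace_eq_iInf _).2 rfl

theorem mul_norm_le_hullSeminorm (V : WeightSequence X) (S : Submodule ℂ C(X, ℂ)) (u : V.hull)
    (f : V.ProjHull S) (x : X) : u.1 x * ‖f.1 x‖ ≤ V.hullSeminorm S u f :=
  le_ciSup (f.2.2 u.1 u.2).2 x

theorem hullSeminorm_le (V : WeightSequence X) (S : Submodule ℂ C(X, ℂ)) (u : V.hull)
    (f : V.ProjHull S) {a : ℝ} (ha : 0 ≤ a) (h : ∀ x, u.1 x * ‖f.1 x‖ ≤ a) :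
    V.hullSeminorm S u f ≤ a :=
  Real.iSup_le h ha

theorem indSubmodule_le_projSubmodule (V : WeightSequence X) (S : Submodule ℂ C(X, ℂ)) :
    V.indSubmodule S ≤ V.projSubmodule S := by
  rintro f ⟨k, hf, a, ha⟩
  refine ⟨hf, fun u hu => ⟨hf, ?_⟩⟩
  obtain ⟨C, hC, hle⟩ := hu k
  refine ⟨C * a, ?_⟩
  rintro _ ⟨x, rfl⟩
  have h1 := mul_le_mul_of_nonneg_left (ha (mem_range_self x)) hC.le
  have h2 := mul_le_mul_of_nonneg_right (hle x) (norm_nonneg (f x))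
  simp only at h1 ⊢
  linarith

theorem indSubmodule_eq_projSubmodule (V : WeightSequence X) (K : CompactExhaustion X)
    (S : Submodule ℂ C(X, ℂ)) : V.indSubmodule S = V.projSubmodule S := by
  refine le_antisymm (V.indSubmodule_le_projSubmodule S) fun f hf => ?_
  obtain ⟨k, M, -, hM⟩ := V.exists_weight_bound K {f} fun u hu => by
    obtain ⟨M, hM⟩ := (hf.2 u hu).2
    refine ⟨M, ?_⟩
    rintro _ rfl x
    exact hM (mem_range_self x)
  refine ⟨k, hf.1, M, ?_⟩
  rintro _ ⟨x, rfl⟩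
  exact hM f rfl x

theorem exists_weight_bound_of_isVonNBounded (V : WeightSequence X) (K : CompactExhaustion X)
    (S : Submodule ℂ C(X, ℂ)) {B : Set (V.ProjHull S)} (hB : Bornology.IsVonNBounded ℂ B) :
    ∃ (k : ℕ+) (M : ℝ), 0 < M ∧ ∀ f ∈ B, ∀ x, V.weight k x * ‖f.1 x‖ ≤ M := by
  rw [(V.withSeminorms_hullSeminorm S).isVonNBounded_iff_seminorm_bounded] at hB
  obtain ⟨k, M, hM, h⟩ := V.exists_weight_bound K ((fun f : V.ProjHull S => f.1) '' B)
    fun u hu => by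
      obtain ⟨r, -, hr⟩ := hB ⟨u, hu⟩
      refine ⟨r, ?_⟩
      rintro _ ⟨f, hf, rfl⟩ x
      exact (V.mul_norm_le_hullSeminorm S ⟨u, hu⟩ f x).trans (hr f hf).le
  exact ⟨k, M, hM, fun f hf => h _ (mem_image_of_mem _ hf)⟩

theorem t2Space_projHull (V : WeightSequence X) (K : CompactExhaustion X)
    (S : Submodule ℂ C(X, ℂ)) : T2Space (V.ProjHull S) := by
  have hW := V.withSeminorms_hullSeminorm S
  have := hW.topologicalAddGroup
  have : T1Space (V.ProjHull S) := by
    refine hW.T1_of_separating fun f hf => ?_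
    by_contra! hcon
    obtain ⟨u, hu⟩ := V.hull_nonempty K
    refine hf (Subtype.ext (ContinuousMap.ext fun x => ?_))
    have h1 := (V.mul_norm_le_hullSeminorm S ⟨u, hu⟩ f x).trans (hcon ⟨u, hu⟩).le
    by_contra h2
    exact absurd h1 (not_le.2 (mul_pos (u.pos_toFun x) (norm_pos_iff.2 h2)))
  infer_instance

theorem continuous_projHull_val (V : WeightSequence X) (K : CompactExhaustion X)
    (S : Submodule ℂ C(X, ℂ)) : Continuous fun f : V.ProjHull S => (f.1 : C(X, ℂ)) := by
  obtain ⟨u, hu⟩ := V.hull_nonempty K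
  rw [continuous_iff_continuousAt]
  intro f₀
  have hlim := ((V.withSeminorms_hullSeminorm S).tendsto_nhds id f₀).1 tendsto_id ⟨u, hu⟩
  rw [ContinuousAt, ContinuousMap.tendsto_iff_forall_isCompact_tendstoUniformlyOn]
  intro L hL
  rw [Metric.tendstoUniformlyOn_iff]
  intro ε hε
  obtain ⟨b, hb⟩ := hL.bddAbove_image
    (continuous_const.div u.continuous_toFun fun x => (u.pos_toFun x).ne' :
      Continuous fun x => 1 / u x).continuousOn
  have hb1 : 0 < max b 1 := lt_max_of_lt_right one_pos
  filter_upwards [hlim (ε / max b 1) (div_pos hε hb1)] with f hf x hx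
  have h1 : u x * ‖f.1 x - f₀.1 x‖ < ε / max b 1 :=
    (V.mul_norm_le_hullSeminorm S ⟨u, hu⟩ (f - f₀) x).trans_lt hf
  have h2 : 1 / u x ≤ max b 1 := (hb (mem_image_of_mem _ hx)).trans (le_max_left _ _)
  rw [div_le_iff₀ (u.pos_toFun x)] at h2
  rw [lt_div_iff₀ hb1] at h1
  rw [dist_comm, dist_eq_norm]
  have h3 := mul_le_mul_of_nonneg_right h2 (norm_nonneg (f.1 x - f₀.1 x))
  linarith

/-- Under condition `(M)`, the projective hull carries the compact-open topology on each set of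
functions which is bounded for some `p_{v_m}`. -/
theorem ConditionM.isInducing_val {V : WeightSequence X} (hV : V.ConditionM)
    (K : CompactExhaustion X) (S : Submodule ℂ C(X, ℂ)) {B : Set (V.ProjHull S)} {m : ℕ+} {M : ℝ}
    (hM : 0 < M) (hB : ∀ f ∈ B, ∀ x, V.weight m x * ‖f.1 x‖ ≤ M) :
    IsInducing fun f : B => (f.1.1 : C(X, ℂ)) := by
  rw [isInducing_iff_nhds]
  intro f₀
  refine le_antisymm (map_le_iff_le_comap.1
    ((V.continuous_projHull_val K S).comp continuous_subtype_val).continuousAt) ?_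
  rw [nhds_subtype_eq_comap, ← map_le_iff_le_comap]
  refine ((V.withSeminorms_hullSeminorm S).tendsto_nhds _ f₀.1).2 fun u ε hε => ?_
  choose D hD hle using u.2
  obtain ⟨N, L, hL, hN⟩ := hV.exists_compact K m (δ := fun k => ε / 2 / (2 * M * D k)) fun k =>
    div_pos (half_pos hε) (mul_pos (mul_pos two_pos hM) (hD k))
  obtain ⟨b, hb⟩ := hL.bddAbove_image u.1.continuous_toFun.continuousOn
  have hb1 : 0 < max b 1 := lt_max_of_lt_right one_pos
  have hlim : Tendsto (fun f : B => (f.1.1 : C(X, ℂ)))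
      (comap (fun f : B => (f.1.1 : C(X, ℂ))) (𝓝 f₀.1.1)) (𝓝 f₀.1.1) := tendsto_comap
  rw [ContinuousMap.tendsto_iff_forall_isCompact_tendstoUniformlyOn] at hlim
  filter_upwards [Metric.tendstoUniformlyOn_iff.1 (hlim L hL) (ε / 2 / max b 1)
    (div_pos (half_pos hε) hb1)] with f hf
  refine (V.hullSeminorm_le S u _ (half_pos hε).le fun x => ?_).trans_lt (half_lt_self hε)
  change u.1 x * ‖f.1.1 x - f₀.1.1 x‖ ≤ ε / 2
  by_cases hx : x ∈ L
  · have h1 := hf x hx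
    rw [dist_comm, dist_eq_norm, lt_div_iff₀ hb1] at h1
    have h2 : u.1 x ≤ max b 1 := (hb (mem_image_of_mem _ hx)).trans (le_max_left _ _)
    have h3 := mul_le_mul_of_nonneg_right h2 (norm_nonneg (f.1.1 x - f₀.1.1 x))
    linarith
  · obtain ⟨k, -, hk⟩ := hN x hx
    have h1 : V.weight m x * ‖f.1.1 x - f₀.1.1 x‖ ≤ 2 * M := by
      have h2 := mul_le_mul_of_nonneg_left (norm_sub_le (f.1.1 x) (f₀.1.1 x))
        ((V.weight m).pos_toFun x).le
      have h3 := hB _ f.2 x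
      have h4 := hB _ f₀.2 x
      linarith
    have h5 : u.1 x ≤ D k * (ε / 2 / (2 * M * D k) * V.weight m x) :=
      (hle k x).trans (mul_le_mul_of_nonneg_left hk.le (hD k).le)
    have h6 : D k * (ε / 2 / (2 * M * D k) * V.weight m x) = ε / 2 / (2 * M) * V.weight m x := by
      have := (hD k).ne'
      field_simp
    calc u.1 x * ‖f.1.1 x - f₀.1.1 x‖
        ≤ ε / 2 / (2 * M) * V.weight m x * ‖f.1.1 x - f₀.1.1 x‖ :=
          mul_le_mul_of_nonneg_right (h6 ▸ h5) (norm_nonneg _)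
      _ = ε / 2 / (2 * M) * (V.weight m x * ‖f.1.1 x - f₀.1.1 x‖) := by ring
      _ ≤ ε / 2 / (2 * M) * (2 * M) := mul_le_mul_of_nonneg_left h1 (by positivity)
      _ = ε / 2 := by field_simp

/-! ### The inductive limit and the projective hull -/

/-- The identity, from the inductive limit to the projective hull. -/
noncomputable def indProjEquiv (V : WeightSequence X) (K : CompactExhaustion X)
    (S : Submodule ℂ C(X, ℂ)) : V.IndLimit S ≃ₗ[ℂ] V.ProjHull S :=
  LinearEquiv.ofEq (V.indSubmodule S) (V.projSubmodule S) (V.indSubmodule_eq_projSubmodule K S)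

theorem continuous_indProjEquiv (V : WeightSequence X) (K : CompactExhaustion X)
    (S : Submodule ℂ C(X, ℂ)) : Continuous (V.indProjEquiv K S) := by
  have hW := V.withSeminorms_hullSeminorm S
  have := hW.topologicalAddGroup
  have := hW.continuousSMul
  have := hW.toLocallyConvexSpace
  rw [continuous_iff_le_induced]
  refine sInf_le ⟨fun k => ?_, ?_, ?_, ?_⟩
  · rw [continuous_induced_rng, continuous_iff_continuousAt]
    intro f₀
    refine (hW.tendsto_nhds _ _).2 fun u ε hε => ?_
    obtain ⟨C, hC, hle⟩ := u.2 k
    filter_upwards [Metric.ball_mem_nhds f₀ (div_pos (half_pos hε) hC)] with f hf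
    rw [Metric.mem_ball, dist_eq_norm, lt_div_iff₀ hC] at hf
    refine (V.hullSeminorm_le S u _ (half_pos hε).le fun x => ?_).trans_lt (half_lt_self hε)
    have h1 : V.weight k x * ‖(f - f₀).1 x‖ ≤ ‖f - f₀‖ := le_ciSup (f - f₀).2.2 x
    have h2 := mul_le_mul_of_nonneg_right (hle x) (norm_nonneg ((f - f₀).1 x))
    have h3 := mul_le_mul_of_nonneg_left h1 hC.le
    change u.1 x * ‖(f - f₀).1 x‖ ≤ ε / 2
    linarith
  · exact topologicalAddGroup_induced (V.indProjEquiv K S)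
  · exact continuousSMul_induced (V.indProjEquiv K S).toLinearMap
  · exact LocallyConvexSpace.induced ((V.indProjEquiv K S).toLinearMap.restrictScalars ℝ)

/-- The inclusion of the `k`-th weighted space in the projective hull. -/
def toProjHull (V : WeightSequence X) (S : Submodule ℂ C(X, ℂ)) (k : ℕ+)
    (f : WeightedSpace S (V.weight k)) : V.ProjHull S :=
  ⟨f.1, V.indSubmodule_le_projSubmodule S ⟨k, f.2⟩⟩

/-- Under condition `(M)` there is, for any radii `ρ`, a weight `u ∈ V̄` such that the functions
`f` in the unit ball of `p_u` which are bounded for some `p_{v_m}` are dominated by finitely many of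
the functions `ρ k / v k`. The number of these depends on `f`, but `u` does not. -/
theorem ConditionM.exists_finite_bound {V : WeightSequence X} (hV : V.ConditionM)
    (K : CompactExhaustion X) {ρ : ℕ+ → ℝ} (hρ : ∀ k, 0 < ρ k) :
    ∃ u : V.hull, ∀ (f : C(X, ℂ)) (m : ℕ+) (M : ℝ), 0 < M →
      (∀ x, V.weight m x * ‖f x‖ ≤ M) → (∀ x, u.1 x * ‖f x‖ ≤ 1) →
      ∃ N : ℕ+, ∀ x, ∃ k ≤ N, ‖f x‖ ≤ ρ k / V.weight k x := by
  obtain ⟨D, u, hCD, h1D, hu, hle, hatt⟩ := V.exists_hull_weight K fun k => (ρ k)⁻¹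
  refine ⟨⟨u, hu⟩, fun f m M hM hf hfu => ?_⟩
  obtain ⟨N₁, L, hL, h₁⟩ := hV.exists_compact K m (δ := fun k => ρ k / M) fun k =>
    div_pos (hρ k) hM
  obtain ⟨N₂, h₂⟩ := hatt L hL
  refine ⟨max N₁ N₂, fun x => ?_⟩
  by_cases hx : x ∈ L
  · obtain ⟨k, hk, hkx⟩ := h₂ x hx
    refine ⟨k, hk.trans (le_max_right _ _), ?_⟩
    have h3 := hfu x
    simp only [hkx] at h3
    have h4 : (ρ k)⁻¹ * (V.weight k x * ‖f x‖) ≤ 1 := by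
      refine le_trans ?_ h3
      rw [mul_assoc]
      exact mul_le_mul_of_nonneg_right (hCD k)
        (mul_nonneg ((V.weight k).pos_toFun x).le (norm_nonneg _))
    rw [inv_mul_le_iff₀ (hρ k), mul_one] at h4
    rw [le_div_iff₀ ((V.weight k).pos_toFun x)]
    linarith
  · obtain ⟨k, hk, hkx⟩ := h₁ x hx
    refine ⟨k, hk.trans (le_max_left _ _), ?_⟩
    rw [le_div_iff₀ ((V.weight k).pos_toFun x)]
    calc ‖f x‖ * V.weight k x ≤ ‖f x‖ * (ρ k / M * V.weight m x) :=
          mul_le_mul_of_nonneg_left hkx.le (norm_nonneg _)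
      _ = ρ k / M * (V.weight m x * ‖f x‖) := by ring
      _ ≤ ρ k / M * M := mul_le_mul_of_nonneg_left (hf x) (div_pos (hρ k) hM).le
      _ = ρ k := by field_simp

/-- A function dominated by the maximum of finitely many `ρ k / v k` is a sum of functions of norm
at most `ρ k` in the weighted spaces: split it in proportion to the `ρ k / v k`. -/
theorem exists_sum_eq_of_norm_le (V : WeightSequence X) {ρ : ℕ+ → ℝ} (hρ : ∀ k, 0 < ρ k)
    {f : C(X, ℂ)} {N : ℕ+} (hf : ∀ x, ∃ k ≤ N, ‖f x‖ ≤ ρ k / V.weight k x) :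
    ∃ h : ℕ+ → C(X, ℂ), f = ∑ k ∈ Finset.Icc 1 N, h k ∧
      ∀ k x, V.weight k x * ‖h k x‖ ≤ ρ k := by
  have hgpos : ∀ k x, 0 < ρ k / V.weight k x := fun k x =>
    div_pos (hρ k) ((V.weight k).pos_toFun x)
  have hgc : ∀ k, Continuous fun x => ρ k / V.weight k x := fun k =>
    continuous_const.div (V.weight k).continuous_toFun fun x => ((V.weight k).pos_toFun x).ne'
  have hsum : ∀ x, 0 < ∑ j ∈ Finset.Icc 1 N, ρ j / V.weight j x := fun x =>
    Finset.sum_pos (fun j _ => hgpos j x) ⟨1, by simp⟩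
  have hfs : ∀ x, ‖f x‖ ≤ ∑ j ∈ Finset.Icc 1 N, ρ j / V.weight j x := fun x => by
    obtain ⟨k, hk, h⟩ := hf x
    exact h.trans (Finset.single_le_sum (f := fun j => ρ j / V.weight j x)
      (fun j _ => (hgpos j x).le) (Finset.mem_Icc.2 ⟨one_le, hk⟩))
  let c : ℕ+ → X → ℝ := fun k x =>
    (ρ k / V.weight k x) / ∑ j ∈ Finset.Icc 1 N, ρ j / V.weight j x
  have hc : ∀ k, Continuous (c k) := fun k =>
    (hgc k).div (continuous_finsetSum _ fun j _ => hgc j) fun x => (hsum x).ne'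
  refine ⟨fun k => ⟨fun x => (c k x : ℂ) * f x,
    (Complex.continuous_ofReal.comp (hc k)).mul f.continuous⟩, ?_, fun k x => ?_⟩
  · ext x
    rw [ContinuousMap.sum_apply]
    simp only [ContinuousMap.coe_mk]
    rw [← Finset.sum_mul, ← Complex.ofReal_sum, ← Finset.sum_div, div_self (hsum x).ne',
      Complex.ofReal_one, one_mul]
  · have h1 : c k x * ‖f x‖ ≤ ρ k / V.weight k x := by
      change (ρ k / V.weight k x) / (∑ j ∈ Finset.Icc 1 N, ρ j / V.weight j x) * ‖f x‖ ≤ _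
      rw [div_mul_eq_mul_div, div_le_iff₀ (hsum x)]
      exact mul_le_mul_of_nonneg_left (hfs x) (hgpos k x).le
    have h0 : 0 ≤ c k x := (div_pos (hgpos k x) (hsum x)).le
    change V.weight k x * ‖(c k x : ℂ) * f x‖ ≤ ρ k
    rw [norm_mul, Complex.norm_real, Real.norm_of_nonneg h0]
    rw [le_div_iff₀ ((V.weight k).pos_toFun x)] at h1
    linarith

/-- Under condition `(M)`, the projective hull of the continuous functions has the universal
property of the locally convex inductive limit. -/
theorem ConditionM.continuous_of_comp_toProjHull {V : WeightSequence X} (hV : V.ConditionM)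
    (K : CompactExhaustion X) {F : Type*} [AddCommGroup F] [Module ℝ F] [TopologicalSpace F]
    [IsTopologicalAddGroup F] [LocallyConvexSpace ℝ F] (T : V.ProjHull ⊤ →ₗ[ℝ] F)
    (hT : ∀ k, Continuous fun f : WeightedSpace ⊤ (V.weight k) => T (V.toProjHull ⊤ k f)) :
    Continuous T := by
  have hW := V.withSeminorms_hullSeminorm ⊤
  have := hW.topologicalAddGroup
  refine continuous_of_continuousAt_zero T ?_
  rw [ContinuousAt, map_zero, (LocallyConvexSpace.convex_basis_zero ℝ F).tendsto_right_iff]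
  rintro U ⟨hU, hconv⟩
  have hball : ∀ k, ∃ ε : ℝ, 0 < ε ∧ ∀ f : WeightedSpace ⊤ (V.weight k), ‖f‖ ≤ ε →
      T (V.toProjHull ⊤ k f) ∈ U := by
    intro k
    have h1 : Tendsto (fun f : WeightedSpace ⊤ (V.weight k) => T (V.toProjHull ⊤ k f)) (𝓝 0)
        (𝓝 0) := (hT k).tendsto' 0 0 (map_zero T)
    obtain ⟨ε, hε, h2⟩ := Metric.nhds_basis_closedBall.mem_iff.1 (h1 hU)
    exact ⟨ε, hε, fun f hf => h2 (mem_closedBall_zero_iff.2 hf)⟩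
  choose ε hε hεU using hball
  obtain ⟨a, ha, c, hac, hc⟩ := NNReal.exists_pos_sum_of_countable one_ne_zero ℕ+
  obtain ⟨u, hu⟩ := hV.exists_finite_bound K (ρ := fun k => a k * ε k) fun k =>
    mul_pos (ha k) (hε k)
  filter_upwards [(hW.tendsto_nhds id 0).1 tendsto_id u 1 one_pos] with f hf
  rw [id, sub_zero] at hf
  have hfi : (f.1 : C(X, ℂ)) ∈ V.indSubmodule ⊤ :=
    (V.indSubmodule_eq_projSubmodule K ⊤).ge f.2
  obtain ⟨m, -, M, hM⟩ := hfi
  obtain ⟨N, hN⟩ := hu f.1 m (max M 1) (lt_max_of_lt_right one_pos)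
    (fun x => (hM (mem_range_self x)).trans (le_max_left _ _))
    fun x => (V.mul_norm_le_hullSeminorm ⊤ u f x).trans hf.le
  obtain ⟨h, hfh, hh⟩ := V.exists_sum_eq_of_norm_le (fun k => mul_pos (ha k) (hε k)) hN
  have hh' : ∀ k x, V.weight k x * ‖(((a k : ℝ) : ℂ)⁻¹ • h k) x‖ ≤ ε k := fun k x => by
    have h1 := hh k x
    have h2 : (0 : ℝ) < a k := ha k
    rw [ContinuousMap.smul_apply, norm_smul, norm_inv, Complex.norm_real,
      Real.norm_of_nonneg h2.le, mul_left_comm, inv_mul_le_iff₀ h2]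
    exact h1
  let p : ∀ k, WeightedSpace ⊤ (V.weight k) := fun k =>
    ⟨((a k : ℝ) : ℂ)⁻¹ • h k, Submodule.mem_top, ε k, by
      rintro _ ⟨x, rfl⟩
      exact hh' k x⟩
  have hpU : ∀ k, T (V.toProjHull ⊤ k (p k)) ∈ U := fun k =>
    hεU k _ (Real.iSup_le (hh' k) (hε k).le)
  have hfp : f = ∑ k ∈ Finset.Icc 1 N, (a k : ℝ) • V.toProjHull ⊤ k (p k) := by
    refine Subtype.ext (hfh.trans ?_)
    have h3 : (((∑ k ∈ Finset.Icc 1 N, (a k : ℝ) • V.toProjHull ⊤ k (p k) :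
        V.ProjHull ⊤).1 : C(X, ℂ))) =
        ∑ k ∈ Finset.Icc 1 N, ((a k : ℝ) : ℂ) • ((a k : ℝ) : ℂ)⁻¹ • h k :=
      map_sum (V.projSubmodule ⊤).subtype _ _
    rw [h3]
    refine Finset.sum_congr rfl fun k _ => ?_
    rw [smul_inv_smul₀]
    exact_mod_cast (ha k).ne'
  have h4 : ∑ k ∈ Finset.Icc 1 N, (a k : ℝ) ≤ 1 := by
    have h5 := (sum_le_hasSum (Finset.Icc 1 N) (fun k _ => zero_le) hac).trans hc.le
    exact_mod_cast h5
  have h6 : 0 < ∑ k ∈ Finset.Icc 1 N, (a k : ℝ) :=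
    Finset.sum_pos (fun k _ => ha k) ⟨1, by simp⟩
  change T f ∈ U
  rw [hfp, map_sum]
  simp only [map_smul]
  -- `f` is a sum with weights `a k` of total at most `1`, so `0 ∈ U` makes up for the rest.
  have h7 := hconv.centerMass_mem (t := Finset.Icc 1 N) (w := fun k => (a k : ℝ))
    (fun k _ => NNReal.coe_nonneg (a k)) h6
    fun k _ => hpU k
  have h8 := hconv.smul_mem_of_zero_mem (mem_of_mem_nhds hU) h7 ⟨h6.le, h4⟩
  rwa [Finset.centerMass, smul_inv_smul₀ h6.ne'] at h8

theorem ConditionM.continuous_indProjEquiv_symm {V : WeightSequence X} (hV : V.ConditionM)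
    (K : CompactExhaustion X) : Continuous (V.indProjEquiv K ⊤).symm := by
  refine continuous_sInf_rng.2 fun t ht => ?_
  obtain ⟨hincl, hgrp, -, hconv⟩ := ht
  exact @ConditionM.continuous_of_comp_toProjHull X _ V hV K (V.IndLimit ⊤) _ _ t hgrp hconv
    ((V.indProjEquiv K ⊤).symm.toLinearMap.restrictScalars ℝ) hincl

end General
end WeightSequence

/-! ### Bounded sets of holomorphic functions -/

section Holomorphic

open Filter Metric

/-- The Weierstrass convergence theorem in several variables: a locally uniform limit of
holomorphic functions is holomorphic. -/
theorem TendstoLocallyUniformlyOn.differentiableOn_normedSpace {E F : Type*}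
    [NormedAddCommGroup E] [NormedSpace ℂ E] [LocallyCompactSpace E]
    [NormedAddCommGroup F] [NormedSpace ℂ F] [CompleteSpace F] {U : Set E}
    (hU : IsOpen U) {f : ℕ → E → F} {g : E → F}
    (hfg : TendstoLocallyUniformlyOn f g atTop U) (hf : ∀ n, DifferentiableOn ℂ (f n) U) :
    DifferentiableOn ℂ g U := by
  intro z hz
  obtain ⟨r, hr, hrU, hunif⟩ : ∃ r > 0, ball z (2 * r) ⊆ U ∧
      UniformCauchySeqOn f atTop (ball z (2 * r)) := by
    obtain ⟨L, hL, hzL, hLU⟩ := exists_compact_subset hU hz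
    obtain ⟨r, hr, hrL⟩ := Metric.mem_nhds_iff.1 (mem_interior_iff_mem_nhds.1 hzL)
    have hrL' : ball z (2 * (r / 2)) ⊆ L := by rwa [mul_div_cancel₀ r two_ne_zero]
    exact ⟨r / 2, half_pos hr, hrL'.trans hLU, (((tendstoLocallyUniformlyOn_iff_forall_isCompact
      hU).1 hfg L hLU hL).mono hrL').uniformCauchySeqOn⟩
  have hUz : ∀ w ∈ ball z r, ball w r ⊆ ball z (2 * r) := fun w hw =>
    ball_subset_ball' (by have := mem_ball.1 hw; linarith)
  have hzz : ball z r ⊆ ball z (2 * r) := ball_subset_ball (by linarith)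
  have hd : ∀ n, ∀ w ∈ ball z r, DifferentiableAt ℂ (f n) w := fun n w hw =>
    (hf n).differentiableAt (hU.mem_nhds (hrU (hzz hw)))
  -- The Schwarz lemma bounds the derivative of `f m - f n` by its supremum on a larger ball.
  have hderiv : UniformCauchySeqOn (fun n => fderiv ℂ (f n)) atTop (ball z r) := by
    rw [Metric.uniformCauchySeqOn_iff] at hunif ⊢
    intro ε hε
    obtain ⟨N, hN⟩ := hunif (ε * r / 4) (by positivity)
    refine ⟨N, fun m hm n hn w hw => ?_⟩
    have hmaps : MapsTo (f m - f n) (ball w r) (closedBall ((f m - f n) w) (ε * r / 2)) := by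
      intro y hy
      have h1 := hN m hm n hn y (hUz w hw hy)
      have h2 := hN m hm n hn w (hzz hw)
      rw [dist_eq_norm] at h1 h2
      rw [mem_closedBall, dist_eq_norm, Pi.sub_apply, Pi.sub_apply]
      have h3 := norm_sub_le (f m y - f n y) (f m w - f n w)
      linarith
    have h4 := Complex.norm_fderiv_le_div_of_mapsTo_ball
      (((hf m).sub (hf n)).mono ((hUz w hw).trans hrU)) hmaps hr
    rw [fderiv_sub (hd m w hw) (hd n w hw)] at h4
    rw [dist_eq_norm]
    refine h4.trans_lt ?_
    rw [div_lt_iff₀ hr]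
    have := mul_pos hε hr
    linarith
  have hlim : ∀ w ∈ ball z r, ∃ A : E →L[ℂ] F,
      Tendsto (fun n => fderiv ℂ (f n) w) atTop (𝓝 A) := fun w hw =>
    cauchySeq_tendsto_of_complete (hderiv.cauchySeq hw)
  choose! A hA using hlim
  exact (hasFDerivAt_of_tendstoUniformlyOn isOpen_ball
    (hderiv.tendstoUniformlyOn_of_tendsto hA) (fun n w hw => (hd n w hw).hasFDerivAt)
    (fun w hw => hfg.tendsto_at (hrU (hzz hw))) (mem_ball_self hr)).differentiableAt
    |>.differentiableWithinAt

variable {E : Type*} [NormedAddCommGroup E] [NormedSpace ℂ E] {G : Set E}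

theorem isClosed_holomorphicSubmodule (hG : IsOpen G) [LocallyCompactSpace E]
    [SigmaCompactSpace G] : IsClosed (holomorphicSubmodule G : Set C(G, ℂ)) := by
  have := hG.locallyCompactSpace
  refine IsSeqClosed.isClosed fun f g hf hfg => ?_
  choose F hF hFf using hf
  classical
  let H : E → ℂ := fun z => if h : z ∈ G then g ⟨z, h⟩ else 0
  have hH : ∀ z : G, H z = g z := fun z => dif_pos z.2
  refine ⟨H, TendstoLocallyUniformlyOn.differentiableOn_normedSpace hG (f := F) ?_ hF, hH⟩
  rw [tendstoLocallyUniformlyOn_iff_tendstoLocallyUniformly_comp_coe]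
  have h1 := ContinuousMap.tendsto_iff_tendstoLocallyUniformly.1 hfg
  convert h1 using 1
  · funext n z
    exact hFf n z
  · funext z
    exact hH z

theorem equicontinuous_holomorphic_of_weight_bound (hG : IsOpen G) (v : Weight G) (M : ℝ)
    {ι : Type*} {f : ι → C(G, ℂ)} (hf : ∀ i, f i ∈ holomorphicSubmodule G)
    (hM : ∀ i x, v x * ‖f i x‖ ≤ M) : Equicontinuous fun i => (f i : G → ℂ) := by
  intro z
  have hv : ∀ᶠ x in 𝓝 z, v z / 2 < v x :=
    v.continuous_toFun.continuousAt.eventually (lt_mem_nhds (half_lt_self (v.pos_toFun z)))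
  obtain ⟨r₁, hr₁, h₁⟩ := Metric.eventually_nhds_iff_ball.1 hv
  obtain ⟨r₂, hr₂, h₂⟩ := Metric.isOpen_iff.1 hG z z.2
  have hr : 0 < min r₁ r₂ := lt_min hr₁ hr₂
  have hsub : ball (z : E) (min r₁ r₂) ⊆ G := (ball_subset_ball (min_le_right _ _)).trans h₂
  have hvz : 0 < v z / 2 := half_pos (v.pos_toFun z)
  have hbound : ∀ i (x : G), dist x z < min r₁ r₂ → ‖f i x‖ ≤ M / (v z / 2) := by
    intro i x hx
    rw [le_div_iff₀ hvz]
    have h3 := h₁ x (mem_ball.2 (hx.trans_le (min_le_left _ _)))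
    have h4 := mul_le_mul_of_nonneg_right h3.le (norm_nonneg (f i x))
    have h5 := hM i x
    linarith
  refine Metric.equicontinuousAt_of_continuity_modulus
    (fun x => 2 * (M / (v z / 2)) / min r₁ r₂ * dist x z) ?_ _ ?_
  · have hc : Continuous fun x : G => 2 * (M / (v z / 2)) / min r₁ r₂ * dist x z := by fun_prop
    exact hc.tendsto' z 0 (by simp)
  · filter_upwards [ball_mem_nhds z hr] with x hx i
    obtain ⟨F, hF, hFf⟩ := hf i
    have hmaps : MapsTo F (ball (z : E) (min r₁ r₂))
        (closedBall (F z) (2 * (M / (v z / 2)))) := by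
      intro y hy
      have h3 := hbound i ⟨y, hsub hy⟩ hy
      have h4 := hbound i z (by rwa [dist_self])
      rw [mem_closedBall, dist_eq_norm, hFf z, show F y = f i ⟨y, hsub hy⟩ from hFf ⟨y, hsub hy⟩]
      have h5 := norm_sub_le (f i ⟨y, hsub hy⟩) (f i z)
      linarith
    have h6 := Complex.dist_le_div_mul_dist_of_mapsTo_ball (hF.mono hsub) hmaps
      (show (x : E) ∈ ball (z : E) (min r₁ r₂) from hx)
    rw [hFf, hFf] at h6
    rw [dist_comm]
    exact h6

/-- Montel's theorem: the holomorphic functions with `v |f| ≤ M` form a compact set in the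
compact-open topology. -/
theorem isCompact_holomorphic_weight_bound (hG : IsOpen G) [LocallyCompactSpace E]
    [SigmaCompactSpace G] (v : Weight G) (M : ℝ) :
    IsCompact {f : C(G, ℂ) | f ∈ holomorphicSubmodule G ∧ ∀ x, v x * ‖f x‖ ≤ M} := by
  set T := {f : C(G, ℂ) | f ∈ holomorphicSubmodule G ∧ ∀ x, v x * ‖f x‖ ≤ M}
  have hclosed : IsClosed T := by
    have hTi : T = (holomorphicSubmodule G : Set C(G, ℂ)) ∩
        ⋂ x, {f : C(G, ℂ) | v x * ‖f x‖ ≤ M} := by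
      ext f
      simp [T]
    rw [hTi]
    refine (isClosed_holomorphicSubmodule hG).inter ?_
    refine isClosed_iInter fun x => isClosed_le ?_ continuous_const
    exact continuous_const.mul (continuous_eval_const x).norm
  rw [← hclosed.closure_eq]
  refine ArzelaAscoli.isCompact_closure_of_isClosedEmbedding (𝔖 := {K : Set G | IsCompact K})
    (F := fun (f : C(G, ℂ)) => (f : G → ℂ)) (fun K hK => hK) ?_ ?_ ?_
  · refine ⟨ContinuousMap.isUniformEmbedding_toUniformOnFunIsCompact.isEmbedding, ?_⟩
    have h := ContinuousMap.range_toUniformOnFunIsCompact (α := G) (β := ℂ)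
    change IsClosed (range ContinuousMap.toUniformOnFunIsCompact)
    rw [h]
    have := hG.locallyCompactSpace
    exact UniformOnFun.isClosed_setOfPred_continuous
      (IsCoherentWith.of_nhds fun x => exists_compact_mem_nhds x)
  · intro K _
    exact (equicontinuous_holomorphic_of_weight_bound hG v M (f := fun i : T => i.1)
      (fun i => i.2.1) fun i => i.2.2).equicontinuousOn K
  · intro K _ x _
    refine ⟨closedBall 0 (M / v x), isCompact_closedBall _ _, fun f hf => ?_⟩
    rw [mem_closedBall_zero_iff, le_div_iff₀ (v.pos_toFun x), mul_comm]
    exact hf.2 x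

theorem WeightSequence.ConditionM.montelSpace_projH {V : WeightSequence G} (hV : V.ConditionM)
    (hG : IsOpen G) [LocallyCompactSpace E] [SigmaCompactSpace G] : MontelSpace ℂ V.ProjH := by
  have := hG.locallyCompactSpace
  let K := CompactExhaustion.choice G
  refine ⟨fun B hBc hBb => ?_⟩
  obtain ⟨m, M, hM, hB⟩ := V.exists_weight_bound_of_isVonNBounded K _ hBb
  have hind := hV.isInducing_val K (holomorphicSubmodule G)
    (B := {f | ∀ x, V.weight m x * ‖f.1 x‖ ≤ M}) hM fun f hf => hf
  refine IsCompact.of_isClosed_subset (isCompact_iff_isCompact_univ.2 (hind.isCompact_iff.2 ?_))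
    hBc hB
  convert isCompact_holomorphic_weight_bound hG (V.weight m) M
  ext f
  constructor
  · rintro ⟨f, -, rfl⟩
    exact ⟨f.1.2.1, f.2⟩
  · rintro ⟨hf, hfM⟩
    refine ⟨⟨⟨f, V.indSubmodule_le_projSubmodule _ ⟨m, hf, M, ?_⟩⟩, hfM⟩, trivial, rfl⟩
    rintro _ ⟨x, rfl⟩
    exact hfM x

end Holomorphic

/-! ### The weights on `G₁ × ℂ` -/

section Concrete

open Filter

theorem expo_lt {k l : ℕ+} (h : k < l) : expo k < expo l := by
  have hk := one_le_cast k
  have h' : (k : ℝ) < l := by exact_mod_cast h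
  unfold expo
  rw [div_lt_div_iff₀ (by linarith) (by linarith)]
  nlinarith

theorem isOpen_Gset : IsOpen Gset := isOpen_G₁.prod isOpen_univ

/-- The function `1 / d(z₁) + |z₂|` tends to infinity as `(z₁, z₂)` leaves the compact
subsets of `G`. -/
theorem exists_isCompact_Gset (R : ℝ) : ∃ L : Set Gset, IsCompact L ∧
    ∀ z ∉ L, R < 1 / distCompl z.1.1 + ‖z.1.2‖ := by
  let A : Set (ℂ × ℂ) :=
    (Metric.closedBall 0 1 ×ˢ Metric.closedBall 0 R) ∩ {z | 1 ≤ R * distCompl z.1}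
  have hA : IsCompact A := by
    refine ((isCompact_closedBall _ _).prod (isCompact_closedBall _ _)).inter_right
      (isClosed_le continuous_const (continuous_const.mul ?_))
    exact (Metric.continuous_infDist_pt _).comp continuous_fst
  have hAG : A ⊆ range (Subtype.val : Gset → ℂ × ℂ) := by
    rw [Subtype.range_coe]
    refine fun z hz => ⟨?_, mem_univ _⟩
    by_contra h
    have h0 : distCompl z.1 = 0 := Metric.infDist_zero_of_mem h
    have h1 : 1 ≤ R * distCompl z.1 := hz.2
    rw [h0, mul_zero] at h1
    exact absurd h1 (by norm_num)
  refine ⟨Subtype.val ⁻¹' A, IsInducing.subtypeVal.isCompact_preimage' hA hAG, fun z hz => ?_⟩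
  by_contra! hR
  have hd := distCompl_pos z.2.1
  have h1 := norm_nonneg z.1.2
  have h2 : 0 < 1 / distCompl z.1.1 := one_div_pos.2 hd
  refine hz ⟨⟨mem_closedBall_zero_iff.2 z.2.1.2.1.le, mem_closedBall_zero_iff.2 (by linarith)⟩, ?_⟩
  have h3 : 1 / distCompl z.1.1 ≤ R := by linarith
  rwa [div_le_iff₀ hd] at h3

theorem AdmissibleMatrix.weight_div_le (Λ : AdmissibleMatrix) {k l : ℕ+} (h : k ≤ l) (z : Gset) :
    Λ.weightSequence.weight l z / Λ.weightSequence.weight k z ≤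
      uFun l z.1.1 ‖z.1.2‖ / uFun k z.1.1 ‖z.1.2‖ := by
  have hw := angularWeight_mono (fun n => Λ.anti n h) z.1.1.arg
  have hwk := angularWeight_pos (fun n => Λ.coeff_pos n k) z.1.1.arg
  have huk := uFun_pos k z.2.1 (norm_nonneg z.1.2)
  have hul := uFun_pos l z.2.1 (norm_nonneg z.1.2)
  change (Λ.wFun l z.1.1 * uFun l z.1.1 ‖z.1.2‖) / (Λ.wFun k z.1.1 * uFun k z.1.1 ‖z.1.2‖) ≤ _
  rw [mul_div_mul_comm]
  exact mul_le_of_le_one_left (div_pos hul huk).le (div_le_one_of_le₀ hw hwk.le)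

theorem AdmissibleMatrix.conditionM (Λ : AdmissibleMatrix) : Λ.weightSequence.ConditionM := by
  intro k Y hY
  -- It suffices to bound the quotient at some points by a negative power of large numbers.
  suffices h : ∃ l, k < l ∧ ∀ R : ℝ, ∃ y ∈ Y, ∃ s, R < s ∧ 1 < s ∧
      uFun l y.1.1 ‖y.1.2‖ / uFun k y.1.1 ‖y.1.2‖ ≤ s ^ (-expo l) / s ^ (-expo k) by
    obtain ⟨l, hkl, h⟩ := h
    refine ⟨l, hkl, ?_, fun b hb => ?_⟩
    · rintro _ ⟨y, -, rfl⟩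
      exact (div_pos ((Λ.weightSequence.weight l).pos_toFun y)
        ((Λ.weightSequence.weight k).pos_toFun y)).le
    · by_contra! hb0
      obtain ⟨R, hR⟩ := eventually_atTop.1
        ((tendsto_rpow_neg_atTop (sub_pos.2 (expo_lt hkl))).eventually (gt_mem_nhds hb0))
      obtain ⟨y, hy, s, hRs, hs, hle⟩ := h R
      have h1 := hR s hRs.le
      have h2 := hb (mem_image_of_mem _ hy)
      have h3 := Λ.weight_div_le hkl.le y
      rw [← Real.rpow_sub (by linarith), show -expo l - -expo k = -(expo l - expo k) by ring] at hle
      linarith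
  -- If `z₂` is bounded on `Y`, then `l` is taken above the bound, and the power is that of
  -- `1 + 1 / d(z₁) + |z₂|`. Otherwise `l = k + 1` and large `|z₂|` will do.
  by_cases hT : ∃ T : ℝ, ∀ y ∈ Y, ‖y.1.2‖ ≤ T
  · obtain ⟨T, hT⟩ := hT
    obtain ⟨n, hn⟩ := exists_nat_gt T
    refine ⟨k + n.succPNat, PNat.lt_add_right _ _, fun R => ?_⟩
    obtain ⟨L, hL, hLR⟩ := exists_isCompact_Gset R
    obtain ⟨y, hy, hyL⟩ : ∃ y ∈ Y, y ∉ L := by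
      by_contra! hYL
      exact hY (hL.closure_of_subset hYL)
    have hR := hLR y hyL
    have hd := one_le_inv_distCompl y.2.1
    have ht := norm_nonneg y.1.2
    refine ⟨y, hy, 1 + 1 / distCompl y.1.1 + ‖y.1.2‖, by linarith, by linarith, ?_⟩
    have hl : ‖y.1.2‖ ≤ ((k + n.succPNat : ℕ+) : ℝ) := by
      have h1 := hT y hy
      have h2 : ((k + n.succPNat : ℕ+) : ℝ) = k + (n + 1) := by push_cast; simp
      have h3 := one_le_cast k
      linarith
    rw [show uFun (k + n.succPNat) y.1.1 ‖y.1.2‖ = _ from if_pos hl]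
    gcongr
    exact le_uFun k y.2.1 ht
  · push Not at hT
    refine ⟨k + 1, PNat.lt_add_right _ _, fun R => ?_⟩
    obtain ⟨y, hy, hyR⟩ := hT (max R (k + 1))
    have h1 := (le_max_left _ _).trans_lt hyR
    have h2 := (le_max_right _ _).trans_lt hyR
    have hk := one_le_cast k
    refine ⟨y, hy, 1 + ‖y.1.2‖, by linarith, by linarith, ?_⟩
    have h3 : uFun k y.1.1 ‖y.1.2‖ = (1 + ‖y.1.2‖) ^ (-expo k) := by
      rw [uFun, if_neg (by linarith), if_neg (by linarith)]
    rw [h3]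
    gcongr
    exact uFun_le (k + 1) y.2.1 (norm_nonneg _)

end Concrete

theorem proposition4 (Λ : AdmissibleMatrix) :
    Λ.weightSequence.ConditionM ∧
    (Λ.weightSequence.indSubmodule ⊤ = Λ.weightSequence.projSubmodule ⊤ ∧
      ∃ e : Λ.weightSequence.IndC ≃L[ℂ] Λ.weightSequence.ProjC,
        ∀ f, (e f).1 = f.1) ∧
    (IsTopologicalAddGroup Λ.weightSequence.ProjH ∧
      ContinuousSMul ℂ Λ.weightSequence.ProjH ∧
      LocallyConvexSpace ℝ Λ.weightSequence.ProjH ∧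
      T2Space Λ.weightSequence.ProjH ∧
      MontelSpace ℂ Λ.weightSequence.ProjH) ∧
    (∀ B : Set Λ.weightSequence.ProjH, Bornology.IsVonNBounded ℂ B →
      TopologicalSpace.MetrizableSpace B) := by
  have := isOpen_Gset.locallyCompactSpace
  let K := CompactExhaustion.choice Gset
  have hM := Λ.conditionM
  have hW := Λ.weightSequence.withSeminorms_hullSeminorm (holomorphicSubmodule Gset)
  refine ⟨hM, ⟨Λ.weightSequence.indSubmodule_eq_projSubmodule K ⊤,
    ⟨Λ.weightSequence.indProjEquiv K ⊤, Λ.weightSequence.continuous_indProjEquiv K ⊤,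
      hM.continuous_indProjEquiv_symm K⟩, fun _ => rfl⟩,
    ⟨hW.topologicalAddGroup, hW.continuousSMul, hW.toLocallyConvexSpace,
      Λ.weightSequence.t2Space_projHull K _, hM.montelSpace_projH isOpen_Gset⟩, fun B hB => ?_⟩
  obtain ⟨m, M, hM0, hBM⟩ := Λ.weightSequence.exists_weight_bound_of_isVonNBounded K _ hB
  exact IsEmbedding.metrizableSpace ⟨hM.isInducing_val K _ hM0 hBM,
    fun f g h => Subtype.ext (Subtype.ext h)⟩
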